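/- Write $\mathbb D(0,r)=\{z\in\mathbb C:|z|<r\}$, $\mathbb D=\mathbb D(0,1)$, and $dA(z)=\frac{dx\,dy}{\pi}$. For $0<r<1$ and a complex polynomial $f$ put $$\Phi_f(z,r)=\left((1-|z|^2)|f(z)|-1_{\mathbb D(0,r)}(z)\right)^2,\qquad z\in\mathbb D,$$ $$\rho_{\mathbb H,r}(f)=\frac{\int_{\mathbb D(0,r)}\Phi_f(z,r)\frac{dA(z)}{1-|z|^2}}{\int_{\mathbb D(0,r)}\frac{dA(z)}{1-|z|^2}},\qquad \rho^*_{\mathbb H,r}(f)=\frac{\int_{\mathbb D}\Phi_f(z,r)\frac{dA(z)}{1-|z|^2}}{\int_{\mathbb D(0,r)}\frac{dA(z)}{1-|z|^2}}.$$ Let $\operatorname{Pol}(\mathbb C)$ be the space of all complex polynomials, let $\operatorname{Pol}_n(\mathbb C)$ be the space of those of degree at most $n-1$, and define the hyperbolic discrepancy densities $$\rho_{\mathbb H}=\liminf_{r\to1^-}\inf_{f\in\operatorname{Pol}(\mathbb C)}\rho_{\mathbb H,r}(f),\qquad \rho^*_{\mathbb H}=\liminf_{r\to1^-}\inf_{f\in\operatorname{Pol}(\mathbb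 C)}\rho^*_{\mathbb H,r}(f).$$ Then, with $n(r)=\left\lceil\frac{r^2}{1-r^2}\right\rceil$, $$\rho_{\mathbb H}=\liminf_{r\to1^-}\inf_{f\in\operatorname{Pol}_{n(r)}(\mathbb C)}\rho_{\mathbb H,r}(f)\qquad\text{and}\qquad \rho^*_{\mathbb H}=\liminf_{r\to1^-}\inf_{f\in\operatorname{Pol}_{n(r)}(\mathbb C)}\rho^*_{\mathbb H,r}(f).$$ -/

import Mathlib

open MeasureTheory Filter Topology Polynomial

noncomputable section

namespace ZeroPacking

/-- The normalized area measure `dA = dx dy / π` on the complex plane. -/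
def area : Measure ℂ := ENNReal.ofReal (1 / Real.pi) • volume

/-- The hyperbolic discrepancy function
`Φ_f(z, r) = ((1 - |z|²) |f(z)| - 1_{D(0,r)}(z))²`. -/
def discrepancy (f : ℂ → ℂ) (z : ℂ) (r : ℝ) : ℝ :=
  ((1 - ‖z‖ ^ 2) * ‖f z‖ - (Metric.ball (0 : ℂ) r).indicator (fun _ => (1 : ℝ)) z) ^ 2

/-- The normalizing factor `∫_{D(0,r)} dA(z) / (1 - |z|²)`. -/
def mass (r : ℝ) : ℝ :=
  ∫ z in Metric.ball (0 : ℂ) r, 1 / (1 - ‖z‖ ^ 2) ∂area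

/-- The functional `ρ_{H,r}(f)`: the average of `Φ_f(·, r)` over the disc `D(0,r)`. -/
def rho (r : ℝ) (f : ℂ[X]) : ℝ :=
  (∫ z in Metric.ball (0 : ℂ) r, discrepancy (fun w => f.eval w) z r / (1 - ‖z‖ ^ 2) ∂area) /
    mass r

/-- The tight functional `ρ*_{H,r}(f)`: here `Φ_f(·, r)` is integrated over the whole unit disc,
with the same normalization as in `ρ_{H,r}(f)`. -/
def rhoTight (r : ℝ) (f : ℂ[X]) : ℝ :=
  (∫ z in Metric.ball (0 : ℂ) 1, discrepancy (fun w => f.eval w) z r / (1 - ‖z‖ ^ 2) ∂area) /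
    mass r

/-- The hyperbolic discrepancy density `ρ_H`. For `0 < r < 1` the infimum lies in `[0, 1]`
(take `f = 0` for the upper bound), so that the real-valued infimum and lower limit are the
usual ones. -/
def rhoH : ℝ := liminf (fun r : ℝ => ⨅ f : ℂ[X], rho r f) (𝓝[<] 1)

/-- The tight hyperbolic discrepancy density `ρ*_H`. -/
def rhoHTight : ℝ := liminf (fun r : ℝ => ⨅ f : ℂ[X], rhoTight r f) (𝓝[<] 1)

/-- `n(r) = ⌈r² / (1 - r²)⌉`, a nonnegative integer for `0 < r < 1`. -/
def degBound (r : ℝ) : ℕ := ⌈r ^ 2 / (1 - r ^ 2)⌉₊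

end ZeroPacking

end

noncomputable section

namespace ZeroPacking

/-! Only one inequality needs proof: cutting a polynomial `f` at degree `n(r)` may raise the
discrepancy by at most an error tending to 0. After division by 1 - |z|², the discrepancy is the
squared L² distance between √(1 - |z|²)|f| and 1_{D(0,r)}/√(1 - |z|²), normalized by L = `mass r` =
-log(1 - r²).

Choose s < r with 1 - s² = L(1 - r²). Replacing the target for r by the one for s costs only √(log
L), since the annulus between them has hyperbolic area log L. Outside D(0,s) the new target vanishes
and truncation can only lower the energy, because monomials are orthogonal on circles
(`energy_annulus_mono`). Inside D(0,s) the discarded tail has only powers at least r²/(1 - r²), so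
shrinking the disc from r to s multiplies its energy by at most L e^{1-L} (`energy_ball_scale_le`).
`lpNorm_truncation_le` and `lpNorm_lowPart_le` combine these. Relative to √L every error vanishes as
r → 1. -/

/-! ### Circle means and polar coordinates. -/

/-- The mean of `‖f‖²` over the circle of radius `t`, in terms of the coefficients of `f`. -/
def circleMean (f : ℂ[X]) (t : ℝ) : ℝ := ∑ k ∈ f.support, ‖f.coeff k‖ ^ 2 * t ^ (2 * k)

theorem continuous_circleMean (f : ℂ[X]) : Continuous (circleMean f) := by
  unfold circleMean; fun_prop

theorem circleMean_nonneg (f : ℂ[X]) (t : ℝ) : 0 ≤ circleMean f t :=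
  Finset.sum_nonneg fun k _ => mul_nonneg (sq_nonneg _) (by rw [pow_mul]; positivity)

theorem circleMean_eq_sum_of_support_subset (f : ℂ[X]) {s : Finset ℕ} (h : f.support ⊆ s) (t : ℝ) :
    circleMean f t = ∑ k ∈ s, ‖f.coeff k‖ ^ 2 * t ^ (2 * k) :=
  Finset.sum_subset h fun k _ hk => by simp [notMem_support_iff.1 hk]

/-- Parseval's identity on the unit circle, applied to the dilated polynomial f(tX). -/
theorem circleMean_eq_circleAverage (f : ℂ[X]) (t : ℝ) :
    circleMean f t = Real.circleAverage (fun z => ‖f.eval z‖ ^ 2) 0 t := by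
  have h := (f.comp (C (t : ℂ) * X)).sum_sq_norm_coeff_eq_circleAverage
  have h1 : Real.circleAverage (fun z => ‖(f.comp (C (t : ℂ) * X)).eval z‖ ^ 2) 0 1
      = Real.circleAverage (fun z => ‖f.eval z‖ ^ 2) 0 t := by
    simp [Real.circleAverage, circleMap]
  rw [← h1, ← h, Finset.sum_subset (s₂ := f.support)]
  · refine Finset.sum_congr rfl fun k _ => ?_
    rw [comp_C_mul_X_coeff, norm_mul, norm_pow, Complex.norm_real, mul_pow, ← pow_mul, mul_comm k,
      Real.norm_eq_abs, pow_mul |t|, sq_abs, pow_mul t]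
  · intro k hk
    rw [mem_support_iff, comp_C_mul_X_coeff] at hk
    exact mem_support_iff.2 (left_ne_zero_of_mul hk)
  · intro k _ hk
    simp [notMem_support_iff.1 hk]

theorem integral_sq_norm_eval_eq_circleMean (f : ℂ[X]) (t : ℝ) :
    ∫ θ in -Real.pi..Real.pi, ‖f.eval (Complex.polarCoord.symm (t, θ))‖ ^ 2
      = 2 * Real.pi * circleMean f t := by
  have hper : Function.Periodic (fun θ : ℝ => ‖f.eval (circleMap 0 t θ)‖ ^ 2) (2 * Real.pi) :=
    fun θ => by simp [periodic_circleMap 0 t θ]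
  have h := hper.intervalIntegral_add_eq (-Real.pi) 0
  rw [show -Real.pi + 2 * Real.pi = Real.pi by ring, zero_add] at h
  rw [circleMean_eq_circleAverage, Real.circleAverage, ← h, smul_eq_mul,
    mul_inv_cancel_left₀ (by positivity)]
  refine intervalIntegral.integral_congr fun θ _ => ?_
  simp [circleMap, Complex.exp_mul_I]

theorem measurableSet_annulus (a b : ℝ) :
    MeasurableSet (Metric.ball (0 : ℂ) b \ Metric.ball 0 a) :=
  measurableSet_ball.diff measurableSet_ball

theorem integral_annulus (f : ℂ[X]) {ψ : ℝ → ℝ} {a b : ℝ} (ha : 0 ≤ a) (hab : a ≤ b)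
    (hψ : ContinuousOn ψ (Set.Icc a b)) :
    ∫ z in Metric.ball (0 : ℂ) b \ Metric.ball 0 a, ψ ‖z‖ * ‖f.eval z‖ ^ 2 ∂area
      = ∫ t in a..b, 2 * t * ψ t * circleMean f t := by
  have hrestr : ∀ S : Set ℂ, area.restrict S
      = ENNReal.ofReal (1 / Real.pi) • (volume.restrict S) := fun S => by
    rw [area, Measure.restrict_smul]
  rw [hrestr, integral_smul_measure, ENNReal.toReal_ofReal (by positivity),
    ← integral_indicator (measurableSet_annulus a b), ← Complex.integral_comp_polarCoord_symm,
    polarCoord_target]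
  set G : ℝ × ℝ → ℝ := fun p => p.1 * (ψ p.1 * ‖f.eval (Complex.polarCoord.symm p)‖ ^ 2) with hG
  have hpc : Continuous fun p : ℝ × ℝ => f.eval (Complex.polarCoord.symm p) := by
    have : Continuous fun p : ℝ × ℝ => Complex.polarCoord.symm p := by
      simp only [Complex.polarCoord_symm_apply]; fun_prop
    fun_prop
  have hGc : ContinuousOn G (Set.Icc a b ×ˢ Set.Icc (-Real.pi) Real.pi) := by
    have : ContinuousOn (fun p : ℝ × ℝ => ψ p.1) (Set.Icc a b ×ˢ Set.Icc (-Real.pi) Real.pi) :=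
      hψ.comp continuousOn_fst fun p hp => hp.1
    exact continuousOn_fst.mul (this.mul (hpc.norm.pow 2).continuousOn)
  have hGi : IntegrableOn G (Set.Ioo a b ×ˢ Set.Ioo (-Real.pi) Real.pi) (volume.prod volume) :=
    (hGc.integrableOn_compact (isCompact_Icc.prod isCompact_Icc)).mono_set
      (Set.prod_mono Set.Ioo_subset_Icc_self Set.Ioo_subset_Icc_self)
  have hae : (Set.Ioi (0 : ℝ) ×ˢ Set.Ioo (-Real.pi) Real.pi ∩
      Set.Ico a b ×ˢ (Set.univ : Set ℝ) : Set (ℝ × ℝ)) =ᵐ[volume]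
      (Set.Ioo a b ×ˢ Set.Ioo (-Real.pi) Real.pi : Set (ℝ × ℝ)) := by
    have h1 : (Set.Ioi (0 : ℝ) ×ˢ Set.Ioo (-Real.pi) Real.pi ∩
      Set.Ico a b ×ˢ (Set.univ : Set ℝ) : Set (ℝ × ℝ)) =
      (Set.Ioi 0 ∩ Set.Ico a b) ×ˢ Set.Ioo (-Real.pi) Real.pi := by
      rw [Set.prod_inter_prod, Set.inter_univ]
    have h2 : (Set.Ioi 0 ∩ Set.Ico a b : Set ℝ) =ᵐ[volume] Set.Ioo a b := by
      have : (Set.Ioo a b : Set ℝ) = Set.Ioi 0 ∩ Set.Ioo a b :=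
        (Set.inter_eq_right.2 fun x hx => lt_of_le_of_lt ha hx.1).symm
      rw [this]
      exact (ae_eq_refl _).inter Ioo_ae_eq_Ico.symm
    rw [h1]
    exact Measure.set_prod_ae_eq h2 (ae_eq_refl _)
  have hpolar : ∫ p in Set.Ioi (0 : ℝ) ×ˢ Set.Ioo (-Real.pi) Real.pi, p.1 •
      (Metric.ball (0 : ℂ) b \ Metric.ball 0 a).indicator
        (fun z => ψ ‖z‖ * ‖f.eval z‖ ^ 2) (Complex.polarCoord.symm p)
      = ∫ p in Set.Ioo a b ×ˢ Set.Ioo (-Real.pi) Real.pi, G p := by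
    rw [← setIntegral_congr_set hae, ← setIntegral_indicator
      (measurableSet_Ico.prod MeasurableSet.univ)]
    refine setIntegral_congr_fun (measurableSet_Ioi.prod measurableSet_Ioo) fun p hp => ?_
    have hn : ‖Complex.polarCoord.symm p‖ = p.1 := by
      rw [Complex.norm_polarCoord_symm, abs_of_pos hp.1]
    have hmem : Complex.polarCoord.symm p ∈ Metric.ball (0 : ℂ) b \ Metric.ball 0 a ↔
        p ∈ Set.Ico a b ×ˢ (Set.univ : Set ℝ) := by
      simp [abs_of_pos (show 0 < p.1 from hp.1), and_comm]
    by_cases hm : p ∈ Set.Ico a b ×ˢ (Set.univ : Set ℝ)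
    · simp only [Set.indicator_of_mem hm, Set.indicator_of_mem (hmem.2 hm), hn, hG, smul_eq_mul]
    · simp only [Set.indicator_of_notMem hm, Set.indicator_of_notMem (mt hmem.1 hm), smul_zero]
  rw [hpolar, Measure.volume_eq_prod, setIntegral_prod _ hGi, smul_eq_mul,
    ← integral_const_mul, intervalIntegral.integral_of_le hab, integral_Ioc_eq_integral_Ioo]
  refine setIntegral_congr_fun measurableSet_Ioo fun t _ => ?_
  simp only [hG]
  have hpi : -Real.pi ≤ Real.pi := by linarith [Real.pi_pos]
  rw [integral_const_mul, integral_const_mul, ← integral_Ioc_eq_integral_Ioo,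
    ← intervalIntegral.integral_of_le hpi, integral_sq_norm_eval_eq_circleMean]
  field_simp

theorem integral_ball (f : ℂ[X]) {ψ : ℝ → ℝ} {b : ℝ} (hb : 0 ≤ b)
    (hψ : ContinuousOn ψ (Set.Icc 0 b)) :
    ∫ z in Metric.ball (0 : ℂ) b, ψ ‖z‖ * ‖f.eval z‖ ^ 2 ∂area
      = ∫ t in 0..b, 2 * t * ψ t * circleMean f t := by
  simpa using integral_annulus f le_rfl hb hψ

theorem one_sub_sq_pos {t : ℝ} (h0 : 0 ≤ t) (h1 : t < 1) : 0 < 1 - t ^ 2 := by nlinarith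

theorem integral_annulus_inv {a b : ℝ} (ha : 0 ≤ a) (hab : a ≤ b) (hb : b < 1) :
    ∫ z in Metric.ball (0 : ℂ) b \ Metric.ball 0 a, 1 / (1 - ‖z‖ ^ 2) ∂area
      = Real.log (1 - a ^ 2) - Real.log (1 - b ^ 2) := by
  have hpos : ∀ t ∈ Set.Icc a b, 1 - t ^ 2 ≠ 0 := fun t ht =>
    (one_sub_sq_pos (ha.trans ht.1) (ht.2.trans_lt hb)).ne'
  have hc : ContinuousOn (fun t : ℝ => 1 / (1 - t ^ 2)) (Set.Icc a b) :=
    continuousOn_const.div (by fun_prop) hpos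
  have h := integral_annulus 1 ha hab hc
  have hM : ∀ t, circleMean 1 t = 1 := fun t => by
    rw [circleMean_eq_circleAverage]; simp [Real.circleAverage_const]
  simp only [eval_one, norm_one, one_pow, mul_one, hM] at h
  rw [h, intervalIntegral.integral_eq_sub_of_hasDerivAt (f := fun t => -Real.log (1 - t ^ 2))]
  · ring
  · intro t ht
    rw [Set.uIcc_of_le hab] at ht
    have h1 : HasDerivAt (fun t : ℝ => 1 - t ^ 2) (-(2 * t)) t := by
      simpa using (hasDerivAt_pow 2 t).const_sub 1
    refine (h1.log (hpos t ht)).neg.congr_deriv ?_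
    ring
  · rw [intervalIntegrable_iff_integrableOn_Icc_of_le hab]
    exact ((by fun_prop : ContinuousOn (fun t : ℝ => 2 * t) _).mul hc).integrableOn_Icc

theorem mass_eq {r : ℝ} (h0 : 0 ≤ r) (h1 : r < 1) : mass r = -Real.log (1 - r ^ 2) := by
  simpa [mass] using integral_annulus_inv le_rfl h0 h1

/-! ### Truncation and weighted energy. -/

/-- The part of `f` of degree less than `n`. -/
def lowPart (n : ℕ) (f : ℂ[X]) : ℂ[X] := ∑ k ∈ Finset.range n, monomial k (f.coeff k)

theorem coeff_lowPart (n : ℕ) (f : ℂ[X]) (k : ℕ) :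
    (lowPart n f).coeff k = if k < n then f.coeff k else 0 := by
  simp [lowPart, coeff_monomial]

theorem lowPart_mem_degreeLT (n : ℕ) (f : ℂ[X]) : lowPart n f ∈ degreeLT ℂ n := by
  rw [mem_degreeLT, degree_lt_iff_coeff_zero]
  intro m hm
  rw [coeff_lowPart, if_neg (by omega)]

/-- The disjunction covers both the truncation of `f` and the tail it leaves. -/
theorem circleMean_le_of_coeff {f g : ℂ[X]} (h : ∀ k, g.coeff k = f.coeff k ∨ g.coeff k = 0)
    (t : ℝ) : circleMean g t ≤ circleMean f t := by
  have hs : g.support ⊆ f.support := fun k hk => by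
    rw [mem_support_iff] at hk ⊢
    rcases h k with h | h
    · rwa [← h]
    · exact absurd h hk
  rw [circleMean_eq_sum_of_support_subset g hs, circleMean]
  refine Finset.sum_le_sum fun k _ => ?_
  have ht : 0 ≤ t ^ (2 * k) := by rw [pow_mul]; positivity
  rcases h k with h | h <;> rw [h]
  simp only [norm_zero, ne_eq, OfNat.ofNat_ne_zero, not_false_eq_true, zero_pow, zero_mul]
  positivity

theorem circleMean_mul_le {h : ℂ[X]} {n : ℕ} (hh : ∀ k < n, h.coeff k = 0) {c : ℝ} (hc0 : 0 ≤ c)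
    (hc1 : c ≤ 1) (t : ℝ) : circleMean h (c * t) ≤ c ^ (2 * n) * circleMean h t := by
  rw [circleMean, circleMean, Finset.mul_sum]
  refine Finset.sum_le_sum fun k hk => ?_
  have hkn : n ≤ k := by
    by_contra hlt
    exact mem_support_iff.1 hk (hh k (not_le.1 hlt))
  have ht : 0 ≤ t ^ (2 * k) := by rw [pow_mul]; positivity
  have : c ^ (2 * k) ≤ c ^ (2 * n) := pow_le_pow_of_le_one hc0 hc1 (by omega)
  rw [mul_pow]
  calc ‖h.coeff k‖ ^ 2 * (c ^ (2 * k) * t ^ (2 * k))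
      = c ^ (2 * k) * (‖h.coeff k‖ ^ 2 * t ^ (2 * k)) := by ring
    _ ≤ _ := by gcongr

/-- The weighted `L²` integral of a polynomial over a set. -/
def energy (A : Set ℂ) (f : ℂ[X]) : ℝ := ∫ z in A, (1 - ‖z‖ ^ 2) * ‖f.eval z‖ ^ 2 ∂area

theorem energy_annulus_mono {f g : ℂ[X]} (h : ∀ k, g.coeff k = f.coeff k ∨ g.coeff k = 0)
    {a b : ℝ} (ha : 0 ≤ a) (hab : a ≤ b) (hb : b ≤ 1) :
    energy (Metric.ball 0 b \ Metric.ball 0 a) g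
      ≤ energy (Metric.ball 0 b \ Metric.ball 0 a) f := by
  have hw : ContinuousOn (fun t : ℝ => 1 - t ^ 2) (Set.Icc a b) := by fun_prop
  rw [energy, energy, integral_annulus g ha hab hw, integral_annulus f ha hab hw]
  have hcont : ∀ p : ℂ[X], Continuous fun t => 2 * t * (1 - t ^ 2) * circleMean p t := fun p => by
    have := continuous_circleMean p
    fun_prop
  refine intervalIntegral.integral_mono_on hab ((hcont g).intervalIntegrable _ _)
    ((hcont f).intervalIntegrable _ _) fun t ht => ?_
  have h0 : 0 ≤ t := ha.trans ht.1
  have h1 : 0 ≤ 1 - t ^ 2 := by nlinarith [ht.2.trans hb]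
  exact mul_le_mul_of_nonneg_left (circleMean_le_of_coeff h t) (by positivity)

/-- Substitute t ↦ ct: the area element 2t dt contributes c², the powers of degree at least `n`
contribute c^(2n), and `l` bounds the ratio of the weights. -/
theorem energy_ball_scale_le {h : ℂ[X]} {n : ℕ} (hh : ∀ k < n, h.coeff k = 0) {r c l : ℝ}
    (hr0 : 0 ≤ r) (hr1 : r < 1) (hc0 : 0 < c) (hc1 : c ≤ 1)
    (hl : 1 - (c * r) ^ 2 ≤ l * (1 - r ^ 2)) :
    energy (Metric.ball 0 (c * r)) h ≤ l * c ^ (2 * (n + 1)) * energy (Metric.ball 0 r) h := by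
  have hw : ∀ b, ContinuousOn (fun t : ℝ => 1 - t ^ 2) (Set.Icc 0 b) := fun b => by fun_prop
  rw [energy, energy, integral_ball h (by positivity) (hw _), integral_ball h hr0 (hw _)]
  have hM := continuous_circleMean h
  have hsub := intervalIntegral.mul_integral_comp_mul_left (a := 0) (b := r) c
    (f := fun t => 2 * t * (1 - t ^ 2) * circleMean h t)
  rw [mul_zero] at hsub
  rw [← hsub, ← intervalIntegral.integral_const_mul, ← intervalIntegral.integral_const_mul]
  refine intervalIntegral.integral_mono_on hr0 (Continuous.intervalIntegrable (by fun_prop) _ _)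
    (Continuous.intervalIntegrable (by fun_prop) _ _) fun t ht => ?_
  have ht0 : 0 ≤ t := ht.1
  have ht2 : t ^ 2 ≤ r ^ 2 := by gcongr; exact ht.2
  have hr2 : r ^ 2 < 1 := by nlinarith
  have hc2 : c ^ 2 ≤ 1 := by nlinarith
  have hct : (c * t) ^ 2 ≤ 1 := by
    rw [mul_pow]; nlinarith [sq_nonneg t]
  -- The difference of the two sides is affine and decreasing in t², so the worst case is t = r,
  -- which is `hl`.
  have hweight : 1 - (c * t) ^ 2 ≤ l * (1 - t ^ 2) := by
    have hl0 : 1 ≤ l := by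
      have h2 : 1 - r ^ 2 ≤ l * (1 - r ^ 2) := by nlinarith [mul_pow c r 2, sq_nonneg r]
      by_contra hlt
      nlinarith
    rw [mul_pow] at hl ⊢
    nlinarith [mul_nonneg (by linarith : 0 ≤ l - c ^ 2) (sub_nonneg.2 ht2)]
  have hk := circleMean_mul_le hh hc0.le hc1 t
  have hM0 := circleMean_nonneg h (c * t)
  calc c * (2 * (c * t) * (1 - (c * t) ^ 2) * circleMean h (c * t))
      = 2 * c ^ 2 * t * ((1 - (c * t) ^ 2) * circleMean h (c * t)) := by ring
    _ ≤ 2 * c ^ 2 * t * ((l * (1 - t ^ 2)) * (c ^ (2 * n) * circleMean h t)) := by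
        refine mul_le_mul_of_nonneg_left ?_ (by positivity)
        exact mul_le_mul hweight hk hM0 ((by linarith : 0 ≤ 1 - (c * t) ^ 2).trans hweight)
    _ = _ := by ring

/-! ### The discrepancy as an L² distance. -/

theorem sq_lpNorm_two {α : Type*} [MeasurableSpace α] {μ : Measure α} {φ : α → ℝ}
    (hφ : AEStronglyMeasurable φ μ) : lpNorm φ 2 μ ^ 2 = ∫ x, φ x ^ 2 ∂μ := by
  have h0 : 0 ≤ ∫ x, φ x ^ 2 ∂μ := integral_nonneg fun _ => sq_nonneg _
  rw [lpNorm_eq_integral_norm_rpow_toReal (by simp) (by simp) hφ]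
  simp only [ENNReal.toReal_ofNat, Real.rpow_ofNat, Real.norm_eq_abs, sq_abs]
  rw [show (2 : ℝ)⁻¹ = 1 / 2 by norm_num, ← Real.sqrt_eq_rpow, Real.sq_sqrt h0]

/-- The square root of the weighted density `(1 - |z|²) |f(z)|²`. -/
def profile (f : ℂ[X]) (z : ℂ) : ℝ := √(1 - ‖z‖ ^ 2) * ‖f.eval z‖

/-- The function `1_{D(0,s)}(z) / √(1 - |z|²)`. -/
def target (s : ℝ) : ℂ → ℝ := (Metric.ball (0 : ℂ) s).indicator fun z => 1 / √(1 - ‖z‖ ^ 2)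

/-- The area measure restricted to the disc `D(0,R)`. -/
abbrev discArea (R : ℝ) : Measure ℂ := area.restrict (Metric.ball 0 R)

theorem norm_lt_of_mem_ball {z : ℂ} {R : ℝ} (hz : z ∈ Metric.ball (0 : ℂ) R) : ‖z‖ < R := by
  simpa using hz

theorem weight_pos {z : ℂ} {R : ℝ} (hR : R ≤ 1) (hz : z ∈ Metric.ball (0 : ℂ) R) :
    0 < 1 - ‖z‖ ^ 2 :=
  one_sub_sq_pos (norm_nonneg z) ((norm_lt_of_mem_ball hz).trans_le hR)

instance isFiniteMeasure_discArea (R : ℝ) : IsFiniteMeasure (discArea R) := by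
  refine ⟨?_⟩
  rw [discArea, Measure.restrict_apply_univ, area, Measure.smul_apply, smul_eq_mul]
  exact ENNReal.mul_lt_top ENNReal.ofReal_lt_top measure_ball_lt_top

theorem continuous_profile (f : ℂ[X]) : Continuous (profile f) := by
  unfold profile; fun_prop

theorem measurable_target (s : ℝ) : Measurable (target s) :=
  Measurable.indicator (by fun_prop) measurableSet_ball

theorem memLp_profile (f : ℂ[X]) (R : ℝ) : MemLp (profile f) 2 (discArea R) := by
  obtain ⟨C, hC⟩ := (isCompact_closedBall (0 : ℂ) R).exists_bound_of_continuousOn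
    (continuous_profile f).continuousOn
  refine MemLp.of_bound (continuous_profile f).aestronglyMeasurable C ?_
  filter_upwards [ae_restrict_mem measurableSet_ball] with z hz
  exact hC z (Metric.ball_subset_closedBall hz)

theorem memLp_target {s : ℝ} (hs0 : 0 ≤ s) (hs1 : s < 1) (R : ℝ) :
    MemLp (target s) 2 (discArea R) := by
  refine MemLp.of_bound (measurable_target s).aestronglyMeasurable (1 / √(1 - s ^ 2))
    (Eventually.of_forall fun z => ?_)
  have hpos := one_sub_sq_pos hs0 hs1
  by_cases hz : z ∈ Metric.ball (0 : ℂ) s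
  · rw [target, Set.indicator_of_mem hz, Real.norm_of_nonneg (by positivity)]
    have h := norm_lt_of_mem_ball hz
    have : 1 - s ^ 2 ≤ 1 - ‖z‖ ^ 2 := by nlinarith [norm_nonneg z]
    have := Real.sqrt_pos.2 hpos
    gcongr
  · rw [target, Set.indicator_of_notMem hz, norm_zero]
    positivity

theorem discrepancy_div_eq {z : ℂ} (hz : 0 < 1 - ‖z‖ ^ 2) (f : ℂ[X]) (s : ℝ) :
    discrepancy (fun w => f.eval w) z s / (1 - ‖z‖ ^ 2) = (profile f z - target s z) ^ 2 := by
  have h := Real.sqrt_pos.2 hz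
  have h2 := Real.sq_sqrt hz.le
  rw [div_eq_iff hz.ne', discrepancy]
  generalize hw : √(1 - ‖z‖ ^ 2) = w at h h2
  by_cases hm : z ∈ Metric.ball (0 : ℂ) s
  · simp only [profile, target, Set.indicator_of_mem hm, hw]
    rw [← h2]
    field_simp
  · simp only [profile, target, Set.indicator_of_notMem hm, hw]
    rw [← h2]
    ring

theorem integral_discrepancy_eq {R s : ℝ} (hR : R ≤ 1) (f : ℂ[X]) :
    ∫ z in Metric.ball (0 : ℂ) R, discrepancy (fun w => f.eval w) z s / (1 - ‖z‖ ^ 2) ∂area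
      = lpNorm (profile f - target s) 2 (discArea R) ^ 2 := by
  rw [sq_lpNorm_two ((continuous_profile f).aestronglyMeasurable.sub
    (measurable_target s).aestronglyMeasurable)]
  exact setIntegral_congr_fun measurableSet_ball fun z hz =>
    discrepancy_div_eq (weight_pos hR hz) f s

theorem sq_profile {z : ℂ} (hz : 0 ≤ 1 - ‖z‖ ^ 2) (f : ℂ[X]) :
    profile f z ^ 2 = (1 - ‖z‖ ^ 2) * ‖f.eval z‖ ^ 2 := by
  rw [profile, mul_pow, Real.sq_sqrt hz]

theorem sq_lpNorm_profile {R : ℝ} (hR : R ≤ 1) (f : ℂ[X]) :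
    lpNorm (profile f) 2 (discArea R) ^ 2 = energy (Metric.ball 0 R) f := by
  rw [sq_lpNorm_two (continuous_profile f).aestronglyMeasurable]
  exact setIntegral_congr_fun measurableSet_ball fun z hz => sq_profile (weight_pos hR hz).le f

/-- The squared difference is 1/(1 - |z|²) on the annulus and 0 elsewhere, so its integral is the
hyperbolic area of the annulus. -/
theorem sq_lpNorm_target_sub {s r R : ℝ} (hs : 0 ≤ s) (hsr : s ≤ r) (hr : r < 1) (hrR : r ≤ R) :
    lpNorm (target s - target r) 2 (discArea R) ^ 2
      = Real.log (1 - s ^ 2) - Real.log (1 - r ^ 2) := by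
  have hr0 := hs.trans hsr
  rw [sq_lpNorm_two ((measurable_target s).aestronglyMeasurable.sub
    (measurable_target r).aestronglyMeasurable), ← integral_annulus_inv hs hsr hr]
  have hsub : Metric.ball (0 : ℂ) R ∩ (Metric.ball 0 r \ Metric.ball 0 s)
      = Metric.ball 0 r \ Metric.ball 0 s :=
    Set.inter_eq_right.2 (Set.sdiff_subset.trans (Metric.ball_subset_ball hrR))
  rw [← hsub, ← setIntegral_indicator (measurableSet_annulus s r)]
  refine setIntegral_congr_fun measurableSet_ball fun z _ => ?_
  by_cases hzr : z ∈ Metric.ball (0 : ℂ) r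
  · by_cases hzs : z ∈ Metric.ball (0 : ℂ) s
    · simp [target, hzr, hzs]
    · rw [Set.indicator_of_mem (show z ∈ Metric.ball 0 r \ Metric.ball 0 s from ⟨hzr, hzs⟩)]
      simp only [Pi.sub_apply, target, Set.indicator_of_mem hzr, Set.indicator_of_notMem hzs]
      rw [zero_sub, neg_sq, div_pow, one_pow, Real.sq_sqrt (weight_pos hr.le hzr).le]
  · have hzs : z ∉ Metric.ball (0 : ℂ) s := fun h => hzr (Metric.ball_subset_ball hsr h)
    rw [Set.indicator_of_notMem fun h : z ∈ Metric.ball (0 : ℂ) r \ Metric.ball 0 s => hzr h.1]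
    simp [target, hzr, hzs]

theorem sq_lpNorm_target {r R : ℝ} (hr0 : 0 ≤ r) (hr : r < 1) (hrR : r ≤ R) :
    lpNorm (target r) 2 (discArea R) ^ 2 = mass r := by
  have h := sq_lpNorm_target_sub le_rfl hr0 hr hrR
  have h0 : target 0 = 0 := by ext; simp [target]
  rw [h0, zero_sub, lpNorm_neg] at h
  rw [h, mass_eq hr0 hr]
  simp

theorem sq_lpNorm_split {s R : ℝ} (hs0 : 0 ≤ s) (hs1 : s < 1) (hsR : s ≤ R) (hR : R ≤ 1)
    (f : ℂ[X]) :
    lpNorm (profile f - target s) 2 (discArea R) ^ 2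
      = lpNorm (profile f - target s) 2 (discArea s) ^ 2
        + energy (Metric.ball 0 R \ Metric.ball 0 s) f := by
  have hm : AEStronglyMeasurable (profile f - target s) area :=
    (continuous_profile f).aestronglyMeasurable.sub (measurable_target s).aestronglyMeasurable
  rw [sq_lpNorm_two hm.restrict, sq_lpNorm_two hm.restrict,
    ← integral_inter_add_sdiff (t := Metric.ball (0 : ℂ) s) measurableSet_ball
      ((memLp_profile f R).sub (memLp_target hs0 hs1 R)).integrable_sq,
    Set.inter_eq_right.2 (Metric.ball_subset_ball hsR)]
  congr 1
  refine setIntegral_congr_fun (measurableSet_annulus s R) fun z hz => ?_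
  simp only [Pi.sub_apply, target, Set.indicator_of_notMem hz.2, sub_zero]
  exact sq_profile (weight_pos hR hz.1).le f

theorem lpNorm_profile_sub_le (f g : ℂ[X]) (R : ℝ) :
    lpNorm (profile g - profile f) 2 (discArea R) ≤ lpNorm (profile (f - g)) 2 (discArea R) := by
  have hm := (memLp_profile g R).sub (memLp_profile f R)
  refine (sq_le_sq₀ lpNorm_nonneg lpNorm_nonneg).1 ?_
  rw [sq_lpNorm_two hm.aestronglyMeasurable,
    sq_lpNorm_two (memLp_profile _ R).aestronglyMeasurable]
  refine integral_mono hm.integrable_sq (memLp_profile _ R).integrable_sq fun z => ?_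
  refine sq_le_sq' ?_ ?_ <;>
  · simp only [Pi.sub_apply, profile, eval_sub]
    have h1 := abs_le.1 (abs_norm_sub_norm_le (f.eval z) (g.eval z))
    nlinarith [Real.sqrt_nonneg (1 - ‖z‖ ^ 2)]

/-! ### The truncation estimate. -/

/-- Replacing `f` by a truncation `g` costs at most the energy of `f - g` in the smaller disc, plus
the change of the target from `r` to `s`. -/
theorem lpNorm_truncation_le {f g : ℂ[X]} (h : ∀ k, g.coeff k = f.coeff k ∨ g.coeff k = 0)
    {s r R : ℝ} (hs : 0 ≤ s) (hsr : s ≤ r) (hr : r < 1) (hrR : r ≤ R) (hR : R ≤ 1) :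
    lpNorm (profile g - target r) 2 (discArea R) ≤ lpNorm (profile f - target r) 2 (discArea R)
      + 2 * √(Real.log (1 - s ^ 2) - Real.log (1 - r ^ 2))
      + lpNorm (profile (f - g)) 2 (discArea s) := by
  have hs1 := hsr.trans_lt hr
  have hsR := hsr.trans hrR
  have hr0 := hs.trans hsr
  have hT : lpNorm (target s - target r) 2 (discArea R)
      = √(Real.log (1 - s ^ 2) - Real.log (1 - r ^ 2)) := by
    rw [← sq_lpNorm_target_sub hs hsr hr hrR, Real.sqrt_sq lpNorm_nonneg]
  have h1 : lpNorm (profile g - target r) 2 (discArea R)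
      ≤ lpNorm (profile g - target s) 2 (discArea R)
        + lpNorm (target s - target r) 2 (discArea R) :=
    lpNorm_sub_le_lpNorm_sub_add_lpNorm_sub (memLp_profile g R) (memLp_target hs hs1 R) (by simp)
  have h2 : lpNorm (profile f - target s) 2 (discArea R)
      ≤ lpNorm (profile f - target r) 2 (discArea R)
        + lpNorm (target s - target r) 2 (discArea R) := by
    rw [lpNorm_sub_comm (target s)]
    exact lpNorm_sub_le_lpNorm_sub_add_lpNorm_sub (memLp_profile f R) (memLp_target hr0 hr R)
      (by simp)
  have h3 : lpNorm (profile g - target s) 2 (discArea s)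
      ≤ lpNorm (profile f - target s) 2 (discArea s)
        + lpNorm (profile (f - g)) 2 (discArea s) := by
    have := lpNorm_sub_le_lpNorm_sub_add_lpNorm_sub (p := 2) (h := target s) (memLp_profile g s)
      (memLp_profile f s) (by simp)
    linarith [lpNorm_profile_sub_le f g s]
  have h4 : lpNorm (profile g - target s) 2 (discArea R)
      ≤ lpNorm (profile f - target s) 2 (discArea R)
        + lpNorm (profile (f - g)) 2 (discArea s) := by
    have hE := energy_annulus_mono h hs hsR hR
    have hg := sq_lpNorm_split hs hs1 hsR hR g
    have hf := sq_lpNorm_split hs hs1 hsR hR f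
    have hE0 : 0 ≤ energy (Metric.ball 0 R \ Metric.ball 0 s) f :=
      setIntegral_nonneg (measurableSet_annulus s R) fun z hz =>
        mul_nonneg (weight_pos hR hz.1).le (sq_nonneg _)
    have n1 : 0 ≤ lpNorm (profile f - target s) 2 (discArea s) := lpNorm_nonneg
    have n2 : 0 ≤ lpNorm (profile f - target s) 2 (discArea R) := lpNorm_nonneg
    have n3 : 0 ≤ lpNorm (profile (f - g)) 2 (discArea s) := lpNorm_nonneg
    have n4 : 0 ≤ lpNorm (profile g - target s) 2 (discArea s) := lpNorm_nonneg
    have h5 : lpNorm (profile f - target s) 2 (discArea s)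
        ≤ lpNorm (profile f - target s) 2 (discArea R) :=
      (sq_le_sq₀ n1 n2).1 (by linarith)
    refine (sq_le_sq₀ lpNorm_nonneg (by positivity)).1 ?_
    have h6 := pow_le_pow_left₀ n4 h3 2
    -- With A, B the distances of `f` to the target on D(0,s) and D(0,R), and E the norm of the
    -- tail: (A + E)² + (B² - A²) ≤ (B + E)², because A ≤ B.
    nlinarith [mul_le_mul_of_nonneg_right h5 n3]
  rw [hT] at h1 h2
  linarith

/-- Removing the terms of degree at least `r² / (1 - r²)` changes the discrepancy very little. -/
theorem lpNorm_lowPart_le {r R l : ℝ} {n : ℕ} (hr0 : 0 < r) (hr : r < 1) (hrR : r ≤ R)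
    (hR : R ≤ 1) (hl1 : 1 ≤ l) (hl : l * (1 - r ^ 2) < 1) (hn : r ^ 2 / (1 - r ^ 2) ≤ n)
    (f : ℂ[X]) :
    lpNorm (profile (lowPart n f) - target r) 2 (discArea R)
      ≤ lpNorm (profile f - target r) 2 (discArea R) + 2 * √(Real.log l)
        + √(l * Real.exp (1 - l))
          * (lpNorm (profile f - target r) 2 (discArea R) + √(mass r)) := by
  have hw := one_sub_sq_pos hr0.le hr
  have hr2 : 0 < r ^ 2 := by positivity
  -- `q` is c², chosen so that s = cr satisfies 1 - s² = l(1 - r²).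
  set q : ℝ := (1 - l * (1 - r ^ 2)) / r ^ 2 with hq
  have hq0 : 0 < q := div_pos (by linarith) hr2
  have hqr : q * r ^ 2 = 1 - l * (1 - r ^ 2) := by rw [hq]; field_simp
  have hq1 : q ≤ 1 := by
    rw [hq, div_le_one hr2]; nlinarith
  set c : ℝ := √q with hc
  have hc0 : 0 < c := Real.sqrt_pos.2 hq0
  have hc1 : c ≤ 1 := Real.sqrt_le_one.2 hq1
  have hc2 : c ^ 2 = q := Real.sq_sqrt hq0.le
  have hs : 1 - (c * r) ^ 2 = l * (1 - r ^ 2) := by rw [mul_pow, hc2, hqr]; ring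
  have hcoef : ∀ k, (lowPart n f).coeff k = f.coeff k ∨ (lowPart n f).coeff k = 0 := fun k => by
    rw [coeff_lowPart]; split_ifs <;> simp
  have hcoef' : ∀ k, (f - lowPart n f).coeff k = f.coeff k ∨ (f - lowPart n f).coeff k = 0 :=
    fun k => by rw [coeff_sub, coeff_lowPart]; split_ifs <;> simp
  have hhigh : ∀ k < n, (f - lowPart n f).coeff k = 0 := fun k hk => by
    rw [coeff_sub, coeff_lowPart, if_pos hk, sub_self]
  have hcr : c * r ≤ r := by nlinarith
  have main := lpNorm_truncation_le hcoef (by positivity : 0 ≤ c * r) hcr hr hrR hR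
  have hlog : Real.log (1 - (c * r) ^ 2) - Real.log (1 - r ^ 2) = Real.log l := by
    rw [hs, Real.log_mul (by positivity) hw.ne']; ring
  rw [hlog] at main
  -- The degree bound enters here: q = 1 - (l - 1)(1 - r²)/r² is at most the exponential of q - 1,
  -- and n ≥ r²/(1 - r²) makes the exponent of the n-th power at most 1 - l.
  have hpow : c ^ (2 * (n + 1)) ≤ Real.exp (1 - l) := by
    have hqe : q ≤ Real.exp (-((l - 1) * (1 - r ^ 2) / r ^ 2)) := by
      refine le_trans (le_of_eq ?_) (Real.add_one_le_exp _)
      rw [hq]; field_simp; ring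
    have hnn : 1 ≤ (1 - r ^ 2) / r ^ 2 * n := by
      rw [div_le_iff₀ hw] at hn
      rw [div_mul_eq_mul_div, le_div_iff₀ hr2]
      linarith
    calc c ^ (2 * (n + 1)) = q ^ (n + 1) := by rw [pow_mul, hc2]
      _ ≤ q ^ n := pow_le_pow_of_le_one hq0.le hq1 (by omega)
      _ ≤ Real.exp (-((l - 1) * (1 - r ^ 2) / r ^ 2)) ^ n := by gcongr
      _ = Real.exp (-((l - 1) * ((1 - r ^ 2) / r ^ 2 * n))) := by
          rw [← Real.exp_nat_mul]; congr 1; ring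
      _ ≤ Real.exp (1 - l) := by
          refine Real.exp_le_exp.2 ?_
          nlinarith
  have hE : lpNorm (profile (f - lowPart n f)) 2 (discArea (c * r))
      ≤ √(l * Real.exp (1 - l)) * lpNorm (profile f) 2 (discArea r) := by
    refine (sq_le_sq₀ lpNorm_nonneg (mul_nonneg (Real.sqrt_nonneg _) lpNorm_nonneg)).1 ?_
    rw [mul_pow, Real.sq_sqrt (by positivity), sq_lpNorm_profile hr.le,
      sq_lpNorm_profile (hcr.trans hr.le)]
    have h1 := energy_ball_scale_le hhigh hr0.le hr hc0 hc1 hs.le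
    have h2 := energy_annulus_mono hcoef' le_rfl hr0.le hr.le
    simp only [Metric.ball_zero, Set.sdiff_empty] at h2
    have h3 : 0 ≤ energy (Metric.ball 0 r) (f - lowPart n f) := by
      rw [← sq_lpNorm_profile hr.le]; positivity
    refine h1.trans (mul_le_mul ?_ h2 h3 (by positivity))
    gcongr
  -- The energy of `f` has no a priori bound; its own discrepancy controls it.
  have hF : lpNorm (profile f) 2 (discArea r)
      ≤ lpNorm (profile f - target r) 2 (discArea R) + √(mass r) := by
    have hT : lpNorm (target r) 2 (discArea r) = √(mass r) := by
      rw [← sq_lpNorm_target hr0.le hr le_rfl, Real.sqrt_sq lpNorm_nonneg]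
    have h1 := lpNorm_le_lpNorm_add_lpNorm_sub' (f := profile f) (memLp_target hr0.le hr r)
      (p := 2) (by simp)
    have h2 : lpNorm (profile f - target r) 2 (discArea r)
        ≤ lpNorm (profile f - target r) 2 (discArea R) := by
      refine (sq_le_sq₀ lpNorm_nonneg lpNorm_nonneg).1 ?_
      have hE0 : 0 ≤ energy (Metric.ball 0 R \ Metric.ball 0 r) f :=
        setIntegral_nonneg (measurableSet_annulus r R) fun z hz =>
          mul_nonneg (weight_pos hR hz.1).le (sq_nonneg _)
      linarith [sq_lpNorm_split hr0.le hr hrR hR f]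
    linarith
  have := mul_le_mul_of_nonneg_left hF (Real.sqrt_nonneg (l * Real.exp (1 - l)))
  linarith

/-! ### Normalization and passage to the lower limit. -/

/-- The discrepancy functional with integration over `D(0,R)`. -/
def rhoDisc (R r : ℝ) (f : ℂ[X]) : ℝ :=
  (∫ z in Metric.ball (0 : ℂ) R, discrepancy (fun w => f.eval w) z r / (1 - ‖z‖ ^ 2) ∂area) /
    mass r

theorem rhoDisc_nonneg {R r : ℝ} (hr0 : 0 ≤ r) (hr : r < 1) (hR : R ≤ 1) (f : ℂ[X]) :
    0 ≤ rhoDisc R r f := by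
  rw [rhoDisc, integral_discrepancy_eq hR, ← sq_lpNorm_target hr0 hr le_rfl]
  positivity

theorem rhoDisc_zero {R r : ℝ} (hr0 : 0 ≤ r) (hr : r < 1) (hrR : r ≤ R) (hR : R ≤ 1)
    (hm : 0 < mass r) : rhoDisc R r 0 = 1 := by
  have h : profile 0 - target r = -target r := by
    ext z; simp [profile]
  rw [rhoDisc, integral_discrepancy_eq hR, h, lpNorm_neg, sq_lpNorm_target hr0 hr hrR,
    div_self hm.ne']

/-- The error in `lpNorm_lowPart_le` after normalization, for `l` the mass. -/
def truncationError (L : ℝ) : ℝ := 2 * √(Real.log L / L) + 2 * √(L * Real.exp (1 - L))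

/-- The choice l = L balances the two errors: log l is negligible against L, and l e^{1-l} still
tends to 0. -/
theorem rhoDisc_lowPart_le {R r : ℝ} (hr0 : 0 < r) (hr : r < 1) (hrR : r ≤ R) (hR : R ≤ 1)
    (hm : 1 ≤ mass r) {f : ℂ[X]} (hf : rhoDisc R r f ≤ 1) :
    rhoDisc R r (lowPart (degBound r) f) ≤ rhoDisc R r f
      + (2 * truncationError (mass r) + truncationError (mass r) ^ 2) := by
  have hw := one_sub_sq_pos hr0.le hr
  set L := mass r with hL
  have hL0 : 0 < L := by linarith
  have hwL : 1 - r ^ 2 = Real.exp (-L) := by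
    rw [hL, mass_eq hr0.le hr, neg_neg, Real.exp_log hw]
  have hlt : L * (1 - r ^ 2) < 1 := by
    rw [hwL, Real.exp_neg, ← div_eq_mul_inv, div_lt_one (Real.exp_pos _)]
    linarith [Real.add_one_le_exp L]
  have key := lpNorm_lowPart_le (n := degBound r) hr0 hr hrR hR hm hlt (Nat.le_ceil _) f
  rw [← hL] at key
  rw [rhoDisc, integral_discrepancy_eq hR, ← hL] at hf ⊢
  rw [rhoDisc, integral_discrepancy_eq hR, ← hL]
  set a := lpNorm (profile f - target r) 2 (discArea R)
  set b := lpNorm (profile (lowPart (degBound r) f) - target r) 2 (discArea R)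
  have ha : 0 ≤ a := lpNorm_nonneg
  have hb : 0 ≤ b := lpNorm_nonneg
  set m := √L with hmdef
  have hm0 : 0 < m := Real.sqrt_pos.2 hL0
  have hm2 : m ^ 2 = L := Real.sq_sqrt hL0.le
  have ham : a ≤ m := by
    rw [div_le_one hL0, ← hm2] at hf
    exact (sq_le_sq₀ ha hm0.le).1 hf
  have hsq : √(Real.log L) = √(Real.log L / L) * m := by
    rw [← Real.sqrt_mul' _ hL0.le, div_mul_cancel₀ _ hL0.ne']
  have hk0 := Real.sqrt_nonneg (L * Real.exp (1 - L))
  have he0 : 0 ≤ truncationError L := by unfold truncationError; positivity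
  -- Since a ≤ √L, the factor a + √L is at most 2√L, whence the second 2 in `truncationError`.
  have hbound : b ≤ a + truncationError L * m := by
    rw [hsq] at key
    have := mul_le_mul_of_nonneg_left ham hk0
    rw [truncationError]
    linarith
  rw [← hm2, div_add' _ _ _ (by positivity), div_le_div_iff_of_pos_right (by positivity), hm2]
  have h2 := pow_le_pow_left₀ hb hbound 2
  nlinarith [mul_le_mul_of_nonneg_right ham (mul_nonneg he0 hm0.le)]

theorem tendsto_truncationError : Tendsto truncationError atTop (𝓝 0) := by
  have h1 : Tendsto (fun L : ℝ => Real.log L / L) atTop (𝓝 0) :=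
    Real.isLittleO_log_id_atTop.tendsto_div_nhds_zero
  have h2 : Tendsto (fun L : ℝ => L * Real.exp (1 - L)) atTop (𝓝 0) := by
    have := (Real.tendsto_pow_mul_exp_neg_atTop_nhds_zero 1).const_mul (Real.exp 1)
    rw [mul_zero] at this
    refine this.congr fun L => ?_
    rw [sub_eq_add_neg, Real.exp_add]; ring
  unfold truncationError
  simpa using (h1.sqrt.const_mul 2).add (h2.sqrt.const_mul 2)

theorem tendsto_mass : Tendsto mass (𝓝[<] 1) atTop := by
  have h1 : Tendsto (fun r : ℝ => 1 - r ^ 2) (𝓝[<] 1) (𝓝[>] 0) := by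
    refine tendsto_nhdsWithin_iff.2 ⟨?_, ?_⟩
    · have : Tendsto (fun r : ℝ => 1 - r ^ 2) (𝓝 1) (𝓝 (1 - 1 ^ 2)) :=
        Continuous.tendsto (by fun_prop) 1
      simpa using this.mono_left nhdsWithin_le_nhds
    · filter_upwards [Ioo_mem_nhdsLT (zero_lt_one' ℝ)] with r hr
      exact one_sub_sq_pos hr.1.le hr.2
  refine (tendsto_neg_atBot_atTop.comp (Real.tendsto_log_nhdsGT_zero.comp h1)).congr' ?_
  filter_upwards [Ioo_mem_nhdsLT (zero_lt_one' ℝ)] with r hr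
  simp [mass_eq hr.1.le hr.2]

/-- The bounds 0 ≤ u and v ≤ 1 keep the real-valued lower limits from taking default values. -/
theorem liminf_eq_of_le_of_le_add {ι : Type*} {F : Filter ι} [F.NeBot] {u v η : ι → ℝ}
    (hη : Tendsto η F (𝓝 0)) (h0 : ∀ᶠ i in F, 0 ≤ u i) (h1 : ∀ᶠ i in F, v i ≤ 1)
    (huv : ∀ᶠ i in F, u i ≤ v i) (hvu : ∀ᶠ i in F, v i ≤ u i + η i) :
    liminf u F = liminf v F := by
  have hub : F.IsBoundedUnder (· ≥ ·) u := ⟨0, h0⟩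
  have hvb : F.IsBoundedUnder (· ≥ ·) v :=
    ⟨0, (h0.and huv).mono fun i h => h.1.trans h.2⟩
  have hvc : F.IsCoboundedUnder (· ≥ ·) v :=
    IsBoundedUnder.isCoboundedUnder_ge ⟨1, h1⟩
  have huc : F.IsCoboundedUnder (· ≥ ·) u :=
    IsBoundedUnder.isCoboundedUnder_ge ⟨1, (h1.and huv).mono fun i h => h.2.trans h.1⟩
  refine le_antisymm (liminf_le_liminf huv hub hvc) (le_of_forall_pos_le_add fun ε hε => ?_)
  rw [← liminf_add_const F u ε huc hub]
  refine liminf_le_liminf ?_ hvb (IsBoundedUnder.isCoboundedUnder_ge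
    ⟨1 + ε, (h1.and huv).mono fun i h => by simpa using h.2.trans h.1⟩)
  filter_upwards [hvu, hη.eventually (gt_mem_nhds hε)] with i h h'
  linarith

theorem liminf_iInf_rhoDisc {R : ℝ → ℝ} (hR : ∀ᶠ r in 𝓝[<] (1 : ℝ), r ≤ R r ∧ R r ≤ 1) :
    liminf (fun r : ℝ => ⨅ f : ℂ[X], rhoDisc (R r) r f) (𝓝[<] 1)
      = liminf (fun r : ℝ => ⨅ f : degreeLT ℂ (degBound r), rhoDisc (R r) r (f : ℂ[X]))
        (𝓝[<] 1) := by
  have herr := tendsto_truncationError.comp tendsto_mass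
  have hη : Tendsto (fun r => 2 * truncationError (mass r) + truncationError (mass r) ^ 2)
      (𝓝[<] 1) (𝓝 0) := by
    simpa using (herr.const_mul 2).add (herr.pow 2)
  have hgood : ∀ᶠ r in 𝓝[<] (1 : ℝ), (0 < r ∧ r < 1) ∧ (r ≤ R r ∧ R r ≤ 1) ∧ 1 ≤ mass r := by
    filter_upwards [Ioo_mem_nhdsLT (zero_lt_one' ℝ), hR, tendsto_mass.eventually_ge_atTop 1]
      with r h1 h2 h3 using ⟨h1, h2, h3⟩
  have hbdd : ∀ {r : ℝ}, 0 < r → r < 1 → R r ≤ 1 → ∀ {ι : Type} (p : ι → ℂ[X]),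
      BddBelow (Set.range fun i => rhoDisc (R r) r (p i)) := fun h0 h1 hR _ p =>
    ⟨0, by rintro _ ⟨i, rfl⟩; exact rhoDisc_nonneg h0.le h1 hR _⟩
  have hle : ∀ {r : ℝ}, 0 < r → r < 1 → R r ≤ 1 → ∀ f : degreeLT ℂ (degBound r),
      ⨅ f : degreeLT ℂ (degBound r), rhoDisc (R r) r (f : ℂ[X]) ≤ rhoDisc (R r) r (f : ℂ[X]) :=
    fun h0 h1 hR f => ciInf_le (hbdd h0 h1 hR fun f : degreeLT ℂ _ => (f : ℂ[X])) f
  have hle_one : ∀ᶠ r in 𝓝[<] (1 : ℝ),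
      ⨅ f : degreeLT ℂ (degBound r), rhoDisc (R r) r (f : ℂ[X]) ≤ 1 := by
    filter_upwards [hgood] with r ⟨⟨h0, h1⟩, ⟨h2, h3⟩, h4⟩
    refine (hle h0 h1 h3 0).trans (le_of_eq ?_)
    exact rhoDisc_zero h0.le h1 h2 h3 (by linarith)
  refine liminf_eq_of_le_of_le_add hη ?_ hle_one ?_ ?_
  · filter_upwards [hgood] with r ⟨⟨h0, h1⟩, ⟨_, h3⟩, _⟩
    exact le_ciInf fun f => rhoDisc_nonneg h0.le h1 h3 f
  · filter_upwards [hgood] with r ⟨⟨h0, h1⟩, ⟨_, h3⟩, _⟩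
    exact le_ciInf fun f => ciInf_le (hbdd h0 h1 h3 fun f : ℂ[X] => f) (f : ℂ[X])
  · filter_upwards [hgood, hle_one] with r ⟨⟨h0, h1⟩, ⟨h2, h3⟩, h4⟩ h5
    rw [← sub_le_iff_le_add]
    refine le_ciInf fun f => sub_le_iff_le_add.2 ?_
    -- If `f` does worse than 1, the zero polynomial, which lies in every `degreeLT`, already beats
    -- it.
    rcases le_or_gt (rhoDisc (R r) r f) 1 with hf | hf
    · exact (hle h0 h1 h3 ⟨lowPart (degBound r) f, lowPart_mem_degreeLT _ _⟩).trans
        (rhoDisc_lowPart_le h0 h1 h2 h3 h4 hf)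
    · have : 0 ≤ truncationError (mass r) := by unfold truncationError; positivity
      nlinarith

end ZeroPacking

end

/-- Here `degreeLT ℂ n` is the space of complex polynomials of degree at most `n - 1`. -/
theorem corollary1p3 :
    ZeroPacking.rhoH =
        liminf (fun r : ℝ => ⨅ f : degreeLT ℂ (ZeroPacking.degBound r),
          ZeroPacking.rho r (f : ℂ[X])) (𝓝[<] 1) ∧
      ZeroPacking.rhoHTight =
        liminf (fun r : ℝ => ⨅ f : degreeLT ℂ (ZeroPacking.degBound r),
          ZeroPacking.rhoTight r (f : ℂ[X])) (𝓝[<] 1) := by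
  have hlt : ∀ᶠ r in 𝓝[<] (1 : ℝ), r ≤ 1 :=
    eventually_nhdsWithin_of_forall fun _ h => le_of_lt h
  -- By definition `rhoDisc r r` is `rho r` and `rhoDisc 1 r` is `rhoTight r`.
  exact ⟨ZeroPacking.liminf_iInf_rhoDisc (R := fun r => r) (hlt.mono fun _ h => ⟨le_rfl, h⟩),
    ZeroPacking.liminf_iInf_rhoDisc (R := fun _ => 1) (hlt.mono fun _ h => ⟨h, le_rfl⟩)⟩
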